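/- For a compact metric space $(K,d)$ let $\mathrm{Lip}(K)$ be the algebra of all continuous functions $f:K\to\mathbb{C}$ with finite Lipschitz number $L(f)=\sup_{x\neq y}\frac{|f(x)-f(y)|}{d(x,y)}<\infty$. Put $\|f\|_\infty=\sup_{x\in K}|f(x)|$, $\|f\|_L=\|f\|_\infty+L(f)$ and $\|f\|_M=\max\{\|f\|_\infty,L(f)\}$, and let $\mathbf 1$ denote the constant function with value $1$. Let $K_1$ and $K_2$ be compact metric spaces. Suppose that $T:\mathrm{Lip}(K_1)\to\mathrm{Lip}(K_2)$ is a surjective complex-linear isometry with respect to the norm $\|\cdot\|_L$ and that $T\mathbf 1=\mathbf 1$. Then there exists a surjective isometry $\varphi:K_2\to K_1$ such that $$Tf(x)=f(\varphi(x)),\qquad f\in\mathrm{Lip}(K_1),\ x\in K_2.$$ Conversely, if $\varphi:K_2\to K_1$ is a surjective isometry, then $f\circ\varphi\in\mathrm{Lip}(K_2)$ for every $f\in\mathrm{Lip}(K_1)$, and the map $T:\mathrm{Lip}(K_1)\to\mathrm{Lip}(K_2)$, $Tf=f\circ\varphi$, is complex-linear, surjective, satisfies $T\mathbf 1=\mathbf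 1$, and is an isometry with respect to both $\|\cdot\|_L$ and $\|\cdot\|_M$. -/

import Mathlib

open scoped ENNReal NNReal

noncomputable section

/-- The Lipschitz number `L(F) = sup_{x ≠ y} |F x - F y| / d(x, y)`, with values in `[0, ∞]`. -/
def lipNumber {K : Type*} [MetricSpace K] (F : C(K, ℂ)) : ℝ≥0∞ :=
  ⨆ (x : K) (y : K) (_ : x ≠ y), ‖F x - F y‖ₑ / edist x y

theorem lipNumber_le_iff {K : Type*} [MetricSpace K] (F : C(K, ℂ)) (C : ℝ≥0) :
    lipNumber F ≤ C ↔ LipschitzWith C F := by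
  unfold lipNumber LipschitzWith
  simp only [iSup_le_iff]
  refine forall₂_congr fun x y => ?_
  rw [edist_eq_enorm_sub]
  by_cases h : x = y
  · simp [h]
  · have h0 : edist x y ≠ 0 := by simpa using h
    rw [ENNReal.div_le_iff h0 (edist_ne_top x y)]
    simp [h]

theorem lipNumber_lt_top_iff {K : Type*} [MetricSpace K] (F : C(K, ℂ)) :
    lipNumber F < ∞ ↔ ∃ C : ℝ≥0, LipschitzWith C F := by
  constructor
  · intro h
    refine ⟨(lipNumber F).toNNReal, (lipNumber_le_iff F _).1 ?_⟩
    rw [ENNReal.coe_toNNReal h.ne]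
  · rintro ⟨C, hC⟩
    exact ((lipNumber_le_iff F C).2 hC).trans_lt ENNReal.coe_lt_top

theorem lipNumber_mul_lt_top {K : Type*} [MetricSpace K] [CompactSpace K] {F G : C(K, ℂ)}
    (hF : lipNumber F < ∞) (hG : lipNumber G < ∞) : lipNumber (F * G) < ∞ := by
  rw [lipNumber_lt_top_iff] at *
  obtain ⟨A, hA⟩ := hF
  obtain ⟨B, hB⟩ := hG
  refine ⟨‖F‖₊ * B + A * ‖G‖₊, LipschitzWith.of_dist_le_mul fun x y => ?_⟩
  have h1 := hA.dist_le_mul x y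
  have h2 := hB.dist_le_mul x y
  rw [dist_eq_norm] at h1 h2
  have h3 : (F * G) x - (F * G) y = F x * (G x - G y) + (F x - F y) * G y := by
    simp only [ContinuousMap.mul_apply]; ring
  rw [dist_eq_norm, h3]
  calc ‖F x * (G x - G y) + (F x - F y) * G y‖
      ≤ ‖F x‖ * ‖G x - G y‖ + ‖F x - F y‖ * ‖G y‖ := by
        refine (norm_add_le _ _).trans ?_
        rw [norm_mul, norm_mul]
    _ ≤ ‖F‖ * (B * dist x y) + (A * dist x y) * ‖G‖ := by
        gcongr
        · exact F.norm_coe_le_norm x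
        · exact G.norm_coe_le_norm y
    _ = _ := by push_cast; ring

/-- `Lip(K)`: the unital algebra of the complex-valued continuous functions on the compact metric
space `K` whose Lipschitz number is finite. -/
def Lip (K : Type*) [MetricSpace K] [CompactSpace K] : Subalgebra ℂ C(K, ℂ) where
  carrier := {F | lipNumber F < ∞}
  mul_mem' hF hG := lipNumber_mul_lt_top hF hG
  add_mem' {F G} hF hG := by
    simp only [Set.mem_ofPred_eq, lipNumber_lt_top_iff] at *
    obtain ⟨A, hA⟩ := hF
    obtain ⟨B, hB⟩ := hG
    exact ⟨A + B, hA.add hB⟩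
  algebraMap_mem' c := by
    simp only [Set.mem_ofPred_eq, lipNumber_lt_top_iff]
    exact ⟨0, LipschitzWith.const c⟩

/-- The sum norm `‖f‖_L = ‖f‖_∞ + L(f)`. -/
def lipSumNorm {K : Type*} [MetricSpace K] [CompactSpace K] (f : Lip K) : ℝ :=
  ‖(f : C(K, ℂ))‖ + (lipNumber (f : C(K, ℂ))).toReal

/-- The max norm `‖f‖_M = max {‖f‖_∞, L(f)}`. -/
def lipMaxNorm {K : Type*} [MetricSpace K] [CompactSpace K] (f : Lip K) : ℝ :=
  max ‖(f : C(K, ℂ))‖ (lipNumber (f : C(K, ℂ))).toReal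

/-- `T` preserves the distances given by `N₁` on the source and by `N₂` on the target. -/
def IsIsometryFor {A B : Type*} [Sub A] [Sub B] (N₁ : A → ℝ) (N₂ : B → ℝ) (T : A → B) : Prop :=
  ∀ f g : A, N₂ (T f - T g) = N₁ (f - g)

end

/-!
As `t → ∞`, the difference `‖f + t·1‖_L - t` tends to `sup Re f + L(f)`, so a unital linear
isometry `T` preserves `sup Re f + L(f)`. Applied to all multiples `c f`, this says that the
ranges of `f` and `T f`, thickened by discs of radii `L(f)` and `L(T f)`, have the same closed
convex hull. If the convex hull of the range of `f` has a corner, it is not the sum of a convex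
set and a disc of positive radius, and hence `L(T f) ≤ L(f)`. Subtracting a small multiple of a
distance function creates a corner, so the inequality holds for all `f`. If `T` is bijective, the
same for `T⁻¹` shows that `T` preserves `L`, and therefore also `sup Re`. The functional `f ↦
f(y)` is singled out by `sup Re` together with the functions `-d(·, y)`, so `T` carries point
evaluations to point evaluations. The resulting map of points and its inverse do not increase
distances, because `T` and `T⁻¹` do not increase the Lipschitz number of distance functions.
-/

open Filter Topology ComplexConjugate

section SupRe

variable {X : Type*} [TopologicalSpace X]

/-- The supremum of the real part of a continuous function; it has the junk value `0` when
`X` is empty or the real part is unbounded above. -/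
noncomputable def supRe (F : C(X, ℂ)) : ℝ := ⨆ x, (F x).re

theorem supRe_le [Nonempty X] {F : C(X, ℂ)} {a : ℝ} (h : ∀ x, (F x).re ≤ a) : supRe F ≤ a :=
  ciSup_le h

variable [CompactSpace X]

theorem re_le_supRe (F : C(X, ℂ)) (x : X) : (F x).re ≤ supRe F :=
  le_ciSup (isCompact_range (Complex.continuous_re.comp F.continuous)).bddAbove x

theorem exists_re_eq_supRe [Nonempty X] (F : C(X, ℂ)) : ∃ x, (F x).re = supRe F := by
  obtain ⟨x, hx⟩ := (isCompact_range (Complex.continuous_re.comp F.continuous)).sSup_mem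
    (Set.range_nonempty _)
  exact ⟨x, hx⟩

theorem supRe_eq_re [Nonempty X] {F : C(X, ℂ)} {a : X} (h : ∀ x, (F x).re ≤ (F a).re) :
    supRe F = (F a).re :=
  (supRe_le h).antisymm (re_le_supRe F a)

theorem supRe_add_le [Nonempty X] (F G : C(X, ℂ)) : supRe (F + G) ≤ supRe F + supRe G :=
  supRe_le fun x => add_le_add (re_le_supRe F x) (re_le_supRe G x)

theorem norm_add_ofReal_le (z : ℂ) {t : ℝ} (ht : 0 < t) :
    ‖z + t‖ ≤ z.re + t + ‖z‖ ^ 2 / (2 * t) := by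
  -- AM-GM: `2 t ‖z + t‖ ≤ ‖z + t‖ ^ 2 + t ^ 2`
  have amgm := two_mul_le_add_sq t ‖z + t‖
  have expand : ‖z + t‖ ^ 2 = ‖z‖ ^ 2 + 2 * t * z.re + t ^ 2 := by
    simp only [Complex.sq_norm, Complex.normSq_apply, Complex.add_re, Complex.add_im,
      Complex.ofReal_re, Complex.ofReal_im]
    ring
  have hdiv : ‖z‖ ^ 2 / (2 * t) * (2 * t) = ‖z‖ ^ 2 := div_mul_cancel₀ _ (by positivity)
  refine le_of_mul_le_mul_right ?_ (show 0 < 2 * t by positivity)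
  linarith

theorem supRe_add_le_norm_add_smul_one [Nonempty X] (F : C(X, ℂ)) (t : ℝ) :
    supRe F + t ≤ ‖F + (t : ℂ) • 1‖ := by
  obtain ⟨x, hx⟩ := exists_re_eq_supRe F
  calc supRe F + t = ((F + (t : ℂ) • 1) x).re := by simp [hx]
    _ ≤ ‖(F + (t : ℂ) • 1) x‖ := Complex.re_le_norm _
    _ ≤ ‖F + (t : ℂ) • 1‖ := ContinuousMap.norm_coe_le_norm _ x

theorem norm_add_smul_one_le [Nonempty X] (F : C(X, ℂ)) {t : ℝ} (ht : 0 < t) :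
    ‖F + (t : ℂ) • 1‖ ≤ supRe F + t + ‖F‖ ^ 2 / (2 * t) := by
  refine (ContinuousMap.norm_le_of_nonempty _).2 fun x => ?_
  calc ‖(F + (t : ℂ) • 1) x‖ = ‖F x + t‖ := by simp
    _ ≤ (F x).re + t + ‖F x‖ ^ 2 / (2 * t) := norm_add_ofReal_le _ ht
    _ ≤ supRe F + t + ‖F‖ ^ 2 / (2 * t) := by
      gcongr
      · exact re_le_supRe F x
      · exact F.norm_coe_le_norm x

theorem tendsto_norm_add_smul_one_sub [Nonempty X] (F : C(X, ℂ)) :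
    Tendsto (fun t : ℝ => ‖F + (t : ℂ) • 1‖ - t) atTop (𝓝 (supRe F)) := by
  have error : Tendsto (fun t : ℝ => ‖F‖ ^ 2 / (2 * t)) atTop (𝓝 0) :=
    (tendsto_id.const_mul_atTop two_pos).const_div_atTop _
  have upper : Tendsto (fun t : ℝ => supRe F + ‖F‖ ^ 2 / (2 * t)) atTop (𝓝 (supRe F)) := by
    simpa only [add_zero] using error.const_add (supRe F)
  refine tendsto_of_tendsto_of_tendsto_of_le_of_le' tendsto_const_nhds upper
    (Eventually.of_forall fun t => ?_) ((eventually_gt_atTop 0).mono fun t ht => ?_)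
  · linarith [supRe_add_le_norm_add_smul_one F t]
  · linarith [norm_add_smul_one_le F ht]

end SupRe

section Corner

/-- The range of `F` has a corner at `F a` pointing in the direction of the positive real axis: it
lies in the sector of the points `z` with `Re (z - F a) ≤ -b |Im (z - F a)|`, which is narrower than
a half-plane when `0 < b`. -/
def HasCornerAt {X : Type*} (b : ℝ) (F : X → ℂ) (a : X) : Prop :=
  ∀ x, (F x - F a).re ≤ -(b * |(F x - F a).im|)

theorem HasCornerAt.re_mul_le {X : Type*} {F : X → ℂ} {a : X} {b : ℝ} (hF : HasCornerAt b F a)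
    (hb : 0 < b) {c : ℂ} (hc : |c.im| ≤ b * c.re) (x : X) : (c * F x).re ≤ (c * F a).re := by
  have hre : 0 ≤ c.re := nonneg_of_mul_nonneg_right ((abs_nonneg _).trans hc) hb
  rw [← sub_nonpos, ← Complex.sub_re, ← mul_sub, Complex.mul_re, sub_nonpos]
  set z := F x - F a
  calc c.re * z.re ≤ c.re * -(b * |z.im|) := by gcongr; exact hF x
    _ = -(b * c.re * |z.im|) := by ring
    _ ≤ -(|c.im| * |z.im|) := by gcongr
    _ ≤ c.im * z.im := by rw [← abs_mul]; exact neg_abs_le _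

theorem HasCornerAt.supRe_smul {X : Type*} [TopologicalSpace X] [CompactSpace X] {F : C(X, ℂ)}
    {a : X} {b : ℝ} (hF : HasCornerAt b F a) (hb : 0 < b) {c : ℂ} (hc : |c.im| ≤ b * c.re) :
    supRe (c • F) = (c * F a).re :=
  have : Nonempty X := ⟨a⟩
  supRe_eq_re (F := c • F) (hF.re_mul_le hb hc)

end Corner

section LipschitzAlgebra

variable {K : Type*} [MetricSpace K]

theorem toReal_lipNumber_le {F : C(K, ℂ)} {C : ℝ} (hC : 0 ≤ C)
    (h : ∀ x y, ‖F x - F y‖ ≤ C * dist x y) : (lipNumber F).toReal ≤ C := by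
  lift C to ℝ≥0 using hC
  refine ENNReal.toReal_le_coe_of_le_coe ((lipNumber_le_iff _ _).2 ?_)
  exact LipschitzWith.of_dist_le_mul fun x y => by simpa only [dist_eq_norm] using h x y

variable [CompactSpace K]

theorem norm_sub_le_lipNumber_mul (f : Lip K) (x y : K) :
    ‖(f : C(K, ℂ)) x - (f : C(K, ℂ)) y‖ ≤ (lipNumber (f : C(K, ℂ))).toReal * dist x y := by
  have hf : LipschitzWith (lipNumber (f : C(K, ℂ))).toNNReal (f : C(K, ℂ)) := by
    rw [← lipNumber_le_iff, ENNReal.coe_toNNReal (show lipNumber (f : C(K, ℂ)) < ∞ from f.2).ne]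
  rw [← dist_eq_norm]
  exact hf.dist_le_mul x y

variable (K) in
/-- The Lipschitz number as a seminorm on `Lip K`. -/
noncomputable def lipSeminorm : Seminorm ℂ (Lip K) :=
  Seminorm.ofSMulLE (fun f => (lipNumber (f : C(K, ℂ))).toReal)
    (le_antisymm (toReal_lipNumber_le le_rfl fun x y => by simp) ENNReal.toReal_nonneg)
    (fun f g => toReal_lipNumber_le (by positivity) fun x y => by
      calc ‖(f : C(K, ℂ)) x + (g : C(K, ℂ)) x - ((f : C(K, ℂ)) y + (g : C(K, ℂ)) y)‖
          ≤ ‖(f : C(K, ℂ)) x - (f : C(K, ℂ)) y‖ + ‖(g : C(K, ℂ)) x - (g : C(K, ℂ)) y‖ := by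
            rw [add_sub_add_comm]; exact norm_add_le _ _
        _ ≤ _ := by
            rw [add_mul]
            gcongr <;> exact norm_sub_le_lipNumber_mul _ x y)
    (fun c f => toReal_lipNumber_le (by positivity) fun x y => by
      calc ‖c * (f : C(K, ℂ)) x - c * (f : C(K, ℂ)) y‖
          = ‖c‖ * ‖(f : C(K, ℂ)) x - (f : C(K, ℂ)) y‖ := by rw [← mul_sub, norm_mul]
        _ ≤ _ := by
            rw [mul_assoc]
            gcongr
            exact norm_sub_le_lipNumber_mul f x y)

theorem norm_sub_le_lipSeminorm_mul (f : Lip K) (x y : K) :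
    ‖(f : C(K, ℂ)) x - (f : C(K, ℂ)) y‖ ≤ lipSeminorm K f * dist x y :=
  norm_sub_le_lipNumber_mul f x y

theorem lipSumNorm_eq_norm_add_lipSeminorm (f : Lip K) :
    lipSumNorm f = ‖(f : C(K, ℂ))‖ + lipSeminorm K f :=
  rfl

theorem lipSeminorm_smul_one (c : ℂ) : lipSeminorm K (c • 1) = 0 :=
  le_antisymm (toReal_lipNumber_le le_rfl fun x y => by simp) (apply_nonneg _ _)

theorem lipSeminorm_add_smul_one (f : Lip K) (c : ℂ) :
    lipSeminorm K (f + c • 1) = lipSeminorm K f := by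
  have add_le := map_add_le_add (lipSeminorm K) f (c • 1)
  have sub_le := map_sub_le_add (lipSeminorm K) (f + c • 1) (c • 1)
  rw [lipSeminorm_smul_one, add_zero] at add_le sub_le
  rw [add_sub_cancel_right] at sub_le
  exact add_le.antisymm sub_le

theorem lipSumNorm_eq_zero_iff {f : Lip K} : lipSumNorm f = 0 ↔ f = 0 := by
  refine ⟨fun h => Subtype.ext (norm_eq_zero.1 ?_), fun h => ?_⟩
  · exact ((add_eq_zero_iff_of_nonneg (norm_nonneg _) (apply_nonneg (lipSeminorm K) f)).1 h).1
  · rw [h, lipSumNorm_eq_norm_add_lipSeminorm, ← zero_smul ℂ (1 : Lip K), lipSeminorm_smul_one,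
      zero_smul, ZeroMemClass.coe_zero, norm_zero, add_zero]

theorem tendsto_lipSumNorm_add_smul_one_sub [Nonempty K] (f : Lip K) :
    Tendsto (fun t : ℝ => lipSumNorm (f + (t : ℂ) • 1) - t) atTop
      (𝓝 (supRe (f : C(K, ℂ)) + lipSeminorm K f)) := by
  refine ((tendsto_norm_add_smul_one_sub (f : C(K, ℂ))).add_const (lipSeminorm K f)).congr
    fun t => ?_
  rw [lipSumNorm_eq_norm_add_lipSeminorm, lipSeminorm_add_smul_one, sub_add_eq_add_sub]
  rfl

/-- The distance to the point `a`, as an element of `Lip K`. -/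
noncomputable def distLip (a : K) : Lip K :=
  ⟨⟨fun x => (dist x a : ℂ), by fun_prop⟩,
    (lipNumber_lt_top_iff _).2 ⟨1 * 1,
      Complex.isometry_ofReal.lipschitz.comp (LipschitzWith.dist_left a)⟩⟩

@[simp]
theorem distLip_apply (a x : K) : (distLip a : C(K, ℂ)) x = (dist x a : ℂ) := rfl

theorem lipSeminorm_distLip_le (a : K) : lipSeminorm K (distLip a) ≤ 1 :=
  toReal_lipNumber_le zero_le_one fun x y => by
    simpa [← Complex.ofReal_sub, Complex.norm_real] using abs_dist_sub_le x y a

theorem eq_of_forall_lip_apply_eq {x y : K}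
    (h : ∀ f : Lip K, (f : C(K, ℂ)) x = (f : C(K, ℂ)) y) : x = y :=
  dist_eq_zero.1 (by simpa using h (distLip y))

theorem nontrivial_lip_iff : Nontrivial (Lip K) ↔ Nonempty K := by
  refine ⟨fun h => ?_, fun h => inferInstance⟩
  by_contra hK
  rw [not_nonempty_iff] at hK
  exact not_subsingleton (Lip K) inferInstance

theorem exists_hasCornerAt_sub_smul_distLip {f : Lip K} {a : K}
    (ha : ∀ x, ((f : C(K, ℂ)) x).re ≤ ((f : C(K, ℂ)) a).re) {ε : ℝ} (hε : 0 < ε) :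
    ∃ b > 0, HasCornerAt b ((f - (ε : ℂ) • distLip a : Lip K) : C(K, ℂ)) a := by
  obtain ⟨b, hb, hbε⟩ := exists_pos_mul_lt hε (lipSeminorm K f)
  refine ⟨b, hb, fun x => ?_⟩
  have im_le : b * |((f : C(K, ℂ)) x - (f : C(K, ℂ)) a).im| ≤ ε * dist x a :=
    calc b * |((f : C(K, ℂ)) x - (f : C(K, ℂ)) a).im|
        ≤ b * (lipSeminorm K f * dist x a) := by
          gcongr
          exact (Complex.abs_im_le_norm _).trans (norm_sub_le_lipSeminorm_mul f x a)
      _ = lipSeminorm K f * b * dist x a := by ring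
      _ ≤ ε * dist x a := by gcongr
  have increment : ((f - (ε : ℂ) • distLip a : Lip K) : C(K, ℂ)) x -
      ((f - (ε : ℂ) • distLip a : Lip K) : C(K, ℂ)) a =
        (f : C(K, ℂ)) x - (f : C(K, ℂ)) a - (ε * dist x a : ℝ) := by
    simp
    ring
  rw [increment, Complex.sub_re, Complex.sub_im, Complex.ofReal_re, Complex.ofReal_im, sub_zero,
    Complex.sub_re]
  linarith [ha x]

end LipschitzAlgebra

section UnitalIsometry

variable {K₁ K₂ : Type*} [MetricSpace K₁] [CompactSpace K₁] [MetricSpace K₂] [CompactSpace K₂]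

/-- A complex-linear map `Lip K₁ → Lip K₂` which preserves the norm `‖·‖_L` and the constant
function `1`. -/
structure IsUnitalLipIsometry (T : Lip K₁ →ₗ[ℂ] Lip K₂) : Prop where
  lipSumNorm_map : ∀ f, lipSumNorm (T f) = lipSumNorm f
  map_one : T 1 = 1

namespace IsUnitalLipIsometry

variable {T : Lip K₁ →ₗ[ℂ] Lip K₂}

theorem injective (hT : IsUnitalLipIsometry T) : Function.Injective T :=
  (injective_iff_map_eq_zero T).2 fun f hf => by
    rwa [← lipSumNorm_eq_zero_iff, hT.lipSumNorm_map, lipSumNorm_eq_zero_iff] at hf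

theorem supRe_add_lipSeminorm_map [Nonempty K₁] [Nonempty K₂] (hT : IsUnitalLipIsometry T)
    (f : Lip K₁) :
    supRe (T f : C(K₂, ℂ)) + lipSeminorm K₂ (T f) = supRe (f : C(K₁, ℂ)) + lipSeminorm K₁ f := by
  refine tendsto_nhds_unique (tendsto_lipSumNorm_add_smul_one_sub (T f))
    ((tendsto_lipSumNorm_add_smul_one_sub f).congr fun t => ?_)
  rw [← hT.lipSumNorm_map, map_add, map_smul, hT.map_one]

/- Put `δ = L(f) - L(Tf)`. For `c` in the sector dual to the corner, `sup Re (c Tf)` equals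
`Re (c f(a)) + |c| δ`. Since `sup Re` is subadditive, `c + conj c = 2` gives `2 δ ≤ 2 |c| δ`, and
`|c| > 1` forces `0 ≤ δ`. -/
theorem lipSeminorm_map_le_of_hasCornerAt [Nonempty K₂] (hT : IsUnitalLipIsometry T)
    {f : Lip K₁} {a : K₁} {b : ℝ} (hb : 0 < b) (hf : HasCornerAt b (f : C(K₁, ℂ)) a) :
    lipSeminorm K₂ (T f) ≤ lipSeminorm K₁ f := by
  have : Nonempty K₁ := ⟨a⟩
  set w := (f : C(K₁, ℂ)) a
  set δ := lipSeminorm K₁ f - lipSeminorm K₂ (T f) with hδ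
  have supRe_smul {c : ℂ} (hc : |c.im| ≤ b * c.re) :
      supRe (c • (T f : C(K₂, ℂ))) = (c * w).re + ‖c‖ * δ := by
    have h := hT.supRe_add_lipSeminorm_map (c • f)
    rw [map_smul, map_smul_eq_mul, map_smul_eq_mul, Subalgebra.coe_smul, Subalgebra.coe_smul,
      hf.supRe_smul hb hc] at h
    rw [hδ]
    linarith
  obtain ⟨c, hc_re, hc_im⟩ : ∃ c : ℂ, c.re = 1 ∧ c.im = b := ⟨⟨1, b⟩, rfl, rfl⟩
  have one_lt_norm : 1 < ‖c‖ := by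
    simpa [hc_re] using Complex.abs_re_lt_norm.2 (hc_im.trans_ne hb.ne')
  have add_conj : c + conj c = 2 := by simp [Complex.add_conj, hc_re]
  have subadd : supRe ((2 : ℂ) • (T f : C(K₂, ℂ))) ≤
      supRe (c • (T f : C(K₂, ℂ))) + supRe (conj c • (T f : C(K₂, ℂ))) := by
    rw [← add_conj, add_smul]
    exact supRe_add_le _ _
  rw [supRe_smul (by simp [hb.le]), supRe_smul (by simp [hc_re, hc_im, abs_of_pos hb]),
    supRe_smul (by simp [hc_re, hc_im, abs_of_pos hb]), RCLike.norm_conj, Complex.norm_ofNat]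
    at subadd
  have re_add : (c * w).re + (conj c * w).re = (2 * w).re := by
    rw [← add_conj, add_mul, Complex.add_re]
  have gap_nonneg : 0 ≤ (‖c‖ - 1) * δ := by linarith
  exact sub_nonneg.1 (nonneg_of_mul_nonneg_right gap_nonneg (sub_pos.2 one_lt_norm))

theorem lipSeminorm_map_le [Nonempty K₁] [Nonempty K₂] (hT : IsUnitalLipIsometry T)
    (f : Lip K₁) : lipSeminorm K₂ (T f) ≤ lipSeminorm K₁ f := by
  obtain ⟨a, ha⟩ := exists_re_eq_supRe (f : C(K₁, ℂ))
  set d := distLip a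
  -- Subtracting `ε d` from `f` creates a corner at the maximum point `a` of `Re f`.
  have approx (ε : ℝ) (hε : 0 < ε) : lipSeminorm K₂ (T f) ≤
      lipSeminorm K₁ f + ε * (lipSeminorm K₁ d + lipSeminorm K₂ (T d)) := by
    obtain ⟨b, hb, hcorner⟩ := exists_hasCornerAt_sub_smul_distLip
      (fun x => (re_le_supRe _ x).trans ha.ge) hε
    calc lipSeminorm K₂ (T f)
        = lipSeminorm K₂ (T (f - (ε : ℂ) • d) + (ε : ℂ) • T d) := by
          rw [map_sub, map_smul, sub_add_cancel]
      _ ≤ lipSeminorm K₂ (T (f - (ε : ℂ) • d)) + lipSeminorm K₂ ((ε : ℂ) • T d) :=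
          map_add_le_add _ _ _
      _ ≤ lipSeminorm K₁ (f - (ε : ℂ) • d) + lipSeminorm K₂ ((ε : ℂ) • T d) := by
          gcongr
          exact hT.lipSeminorm_map_le_of_hasCornerAt hb hcorner
      _ ≤ lipSeminorm K₁ f + lipSeminorm K₁ ((ε : ℂ) • d) + lipSeminorm K₂ ((ε : ℂ) • T d) := by
          gcongr
          exact map_sub_le_add _ _ _
      _ = lipSeminorm K₁ f + ε * (lipSeminorm K₁ d + lipSeminorm K₂ (T d)) := by
          rw [map_smul_eq_mul, map_smul_eq_mul, Complex.norm_of_nonneg hε.le]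
          ring
  have limit : Tendsto (fun ε : ℝ => lipSeminorm K₁ f + ε * (lipSeminorm K₁ d +
      lipSeminorm K₂ (T d))) (𝓝[>] 0) (𝓝 (lipSeminorm K₁ f)) :=
    tendsto_nhdsWithin_of_tendsto_nhds (Continuous.tendsto' (by fun_prop) _ _ (by simp))
  exact ge_of_tendsto limit (eventually_mem_nhdsWithin.mono approx)

end IsUnitalLipIsometry

end UnitalIsometry

section SurjectiveUnitalIsometry

variable {K₁ K₂ : Type*} [MetricSpace K₁] [CompactSpace K₁] [MetricSpace K₂] [CompactSpace K₂]

theorem eq_zero_of_forall_re_nonpos {E : Type*} [AddCommGroup E] [Module ℂ E] {l : E →ₗ[ℂ] ℂ}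
    (h : ∀ v, (l v).re ≤ 0) : l = 0 := by
  ext v
  have hv := h (conj (l v) • v)
  rw [map_smul, smul_eq_mul, Complex.conj_mul', ← Complex.ofReal_pow, Complex.ofReal_re] at hv
  simpa using hv

theorem lipschitzWith_one_of_lipSeminorm_comp_le {T : Lip K₁ → Lip K₂} {φ : K₂ → K₁}
    (hTφ : ∀ f x, (T f : C(K₂, ℂ)) x = (f : C(K₁, ℂ)) (φ x))
    (hT : ∀ f, lipSeminorm K₂ (T f) ≤ lipSeminorm K₁ f) : LipschitzWith 1 φ := by
  refine LipschitzWith.of_dist_le_mul fun x y => ?_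
  set d := distLip (φ y)
  calc dist (φ x) (φ y) = ‖(T d : C(K₂, ℂ)) x - (T d : C(K₂, ℂ)) y‖ := by simp [hTφ, d]
    _ ≤ lipSeminorm K₂ (T d) * dist x y := norm_sub_le_lipSeminorm_mul _ x y
    _ ≤ 1 * dist x y := by
      gcongr
      exact (hT d).trans (lipSeminorm_distLip_le _)

/-- Evaluation at a point as a linear functional on `Lip K`. -/
noncomputable def lipEval {K : Type*} [MetricSpace K] [CompactSpace K] (x : K) : Lip K →ₗ[ℂ] ℂ :=
  LinearMap.proj x ∘ₗ (ContinuousMap.coeFnLinearMap ℂ) ∘ₗ (Lip K).val.toLinearMap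

namespace IsUnitalLipIsometry

variable {T : Lip K₁ ≃ₗ[ℂ] Lip K₂}

theorem symm (hT : IsUnitalLipIsometry T.toLinearMap) :
    IsUnitalLipIsometry T.symm.toLinearMap where
  lipSumNorm_map g := by simpa using (hT.lipSumNorm_map (T.symm g)).symm
  map_one := T.symm_apply_eq.2 hT.map_one.symm

variable [Nonempty K₁] [Nonempty K₂]

theorem lipSeminorm_map (hT : IsUnitalLipIsometry T.toLinearMap) (f : Lip K₁) :
    lipSeminorm K₂ (T f) = lipSeminorm K₁ f :=
  (hT.lipSeminorm_map_le f).antisymm (by simpa using hT.symm.lipSeminorm_map_le (T f))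

theorem supRe_map (hT : IsUnitalLipIsometry T.toLinearMap) (f : Lip K₁) :
    supRe (T f : C(K₂, ℂ)) = supRe (f : C(K₁, ℂ)) := by
  have h := hT.supRe_add_lipSeminorm_map f
  rwa [LinearEquiv.coe_coe, hT.lipSeminorm_map, add_left_inj] at h

/- The point `x` is a zero of the image of the distance to `y`, and `Re f - L(f) d(·, y)` is
maximal at `y`, so `Re Tf(x) ≤ Re f(y)`. -/
theorem exists_forall_map_apply_eq (hT : IsUnitalLipIsometry T.toLinearMap) (y : K₁) :
    ∃ x : K₂, ∀ f, (T f : C(K₂, ℂ)) x = (f : C(K₁, ℂ)) y := by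
  obtain ⟨x, hx⟩ := exists_re_eq_supRe (T (-distLip y) : C(K₂, ℂ))
  have map_dist : ((T (distLip y) : C(K₂, ℂ)) x).re = 0 := by
    rw [hT.supRe_map, supRe_eq_re (a := y) fun z => by simp] at hx
    simpa using hx
  have re_le (f : Lip K₁) : ((T f : C(K₂, ℂ)) x).re ≤ ((f : C(K₁, ℂ)) y).re := by
    set g : Lip K₁ := f - (lipSeminorm K₁ f : ℂ) • distLip y with hg
    have g_le (z : K₁) : ((g : C(K₁, ℂ)) z).re ≤ ((f : C(K₁, ℂ)) y).re := by
      have h := (Complex.re_le_norm _).trans (norm_sub_le_lipSeminorm_mul f z y)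
      rw [Complex.sub_re] at h
      simpa [hg, add_comm] using h
    calc ((T f : C(K₂, ℂ)) x).re = ((T g : C(K₂, ℂ)) x).re := by
          rw [hg, map_sub, map_smul]; simp [map_dist]
      _ ≤ supRe (T g : C(K₂, ℂ)) := re_le_supRe _ x
      _ = supRe (g : C(K₁, ℂ)) := hT.supRe_map g
      _ ≤ ((f : C(K₁, ℂ)) y).re := supRe_le g_le
  have eval_eq : lipEval x ∘ₗ T.toLinearMap - lipEval y = 0 :=
    eq_zero_of_forall_re_nonpos fun f => sub_nonpos.2 (re_le f)
  exact ⟨x, fun f => sub_eq_zero.1 (LinearMap.congr_fun eval_eq f)⟩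

theorem exists_lipschitzWith_one_comp (hT : IsUnitalLipIsometry T.toLinearMap) :
    ∃ φ : K₂ → K₁, LipschitzWith 1 φ ∧ ∀ f x, (T f : C(K₂, ℂ)) x = (f : C(K₁, ℂ)) (φ x) := by
  choose φ hφ using hT.symm.exists_forall_map_apply_eq
  have hTφ (f : Lip K₁) (x : K₂) : (T f : C(K₂, ℂ)) x = (f : C(K₁, ℂ)) (φ x) := by
    simpa using (hφ x (T f)).symm
  exact ⟨φ, lipschitzWith_one_of_lipSeminorm_comp_le hTφ hT.lipSeminorm_map_le, hTφ⟩

theorem exists_isometry_comp (hT : IsUnitalLipIsometry T.toLinearMap) :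
    ∃ φ : K₂ → K₁, Isometry φ ∧ Function.Surjective φ ∧
      ∀ f x, (T f : C(K₂, ℂ)) x = (f : C(K₁, ℂ)) (φ x) := by
  obtain ⟨φ, φ_lip, hφ⟩ := hT.exists_lipschitzWith_one_comp
  obtain ⟨ψ, ψ_lip, hψ⟩ := hT.symm.exists_lipschitzWith_one_comp
  have left_inv : Function.LeftInverse ψ φ := fun x =>
    eq_of_forall_lip_apply_eq fun g => by rw [← hψ, ← hφ, T.apply_symm_apply]
  have right_inv : Function.RightInverse ψ φ := fun y =>
    eq_of_forall_lip_apply_eq fun f => by rw [← hφ, ← hψ, T.symm_apply_apply]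
  have φ_antilip : AntilipschitzWith 1 φ := ψ_lip.to_rightInverse left_inv
  refine ⟨φ, fun x y => le_antisymm ?_ ?_, right_inv.surjective, hφ⟩
  · simpa using φ_lip x y
  · simpa using φ_antilip x y

end IsUnitalLipIsometry

end SurjectiveUnitalIsometry

section Pullback

theorem norm_comp_of_surjective {X Y E : Type*} [TopologicalSpace X] [CompactSpace X]
    [TopologicalSpace Y] [CompactSpace Y] [SeminormedAddCommGroup E] {φ : C(X, Y)}
    (hφ : Function.Surjective φ) (F : C(Y, E)) : ‖F.comp φ‖ = ‖F‖ := by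
  rw [ContinuousMap.norm_eq_iSup_norm, ContinuousMap.norm_eq_iSup_norm]
  exact hφ.iSup_comp (g := fun y => ‖F y‖)

theorem lipNumber_comp_of_isometry {K₁ K₂ : Type*} [MetricSpace K₁] [MetricSpace K₂]
    {φ : C(K₂, K₁)} (hφ : Isometry φ) (hsurj : Function.Surjective φ) (F : C(K₁, ℂ)) :
    lipNumber (F.comp φ) = lipNumber F := by
  simp only [lipNumber, ← hsurj.iSup_comp, ContinuousMap.comp_apply, hφ.edist_eq,
    hφ.injective.ne_iff]

theorem isIsometryFor_iff {A B G : Type*} [AddGroup A] [AddGroup B] [FunLike G A B]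
    [AddMonoidHomClass G A B] {N₁ : A → ℝ} {N₂ : B → ℝ} {T : G} :
    IsIsometryFor N₁ N₂ T ↔ ∀ f, N₂ (T f) = N₁ f :=
  ⟨fun h f => by simpa using h f 0, fun h f g => by rw [← map_sub, h]⟩

variable {K₁ K₂ : Type*} [MetricSpace K₁] [CompactSpace K₁] [MetricSpace K₂] [CompactSpace K₂]

theorem comp_mem_lip {φ : C(K₂, K₁)} {C : ℝ≥0} (hφ : LipschitzWith C φ) (f : Lip K₁) :
    (f : C(K₁, ℂ)).comp φ ∈ Lip K₂ := by
  obtain ⟨D, hD⟩ := (lipNumber_lt_top_iff (f : C(K₁, ℂ))).1 f.2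
  exact (lipNumber_lt_top_iff _).2 ⟨D * C, hD.comp hφ⟩

/-- Composition with a Lipschitz map `φ : K₂ → K₁`, as a homomorphism `Lip K₁ → Lip K₂`. -/
noncomputable def lipPullback {φ : C(K₂, K₁)} {C : ℝ≥0} (hφ : LipschitzWith C φ) :
    Lip K₁ →ₐ[ℂ] Lip K₂ :=
  ((φ.compRightAlgHom ℂ ℂ).comp (Lip K₁).val).codRestrict (Lip K₂) (comp_mem_lip hφ)

@[simp]
theorem coe_lipPullback {φ : C(K₂, K₁)} {C : ℝ≥0} (hφ : LipschitzWith C φ) (f : Lip K₁) :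
    (lipPullback hφ f : C(K₂, ℂ)) = (f : C(K₁, ℂ)).comp φ :=
  rfl

theorem lipPullback_surjective {φ : C(K₂, K₁)} {C : ℝ≥0} (hφ : LipschitzWith C φ)
    {ψ : K₁ → K₂} {D : ℝ≥0} (hψ : LipschitzWith D ψ) (hψφ : Function.LeftInverse ψ φ) :
    Function.Surjective (lipPullback hφ) := fun g => by
  let Ψ : C(K₁, K₂) := ⟨ψ, hψ.continuous⟩
  have hΨ : LipschitzWith D Ψ := hψ
  refine ⟨lipPullback hΨ g, Subtype.ext (ContinuousMap.ext fun x => ?_)⟩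
  exact congrArg (g : C(K₂, ℂ)) (hψφ x)

theorem lipSumNorm_lipPullback {φ : C(K₂, K₁)} (hφ : Isometry φ) (hsurj : Function.Surjective φ)
    (f : Lip K₁) : lipSumNorm (lipPullback hφ.lipschitz f) = lipSumNorm f := by
  rw [lipSumNorm, coe_lipPullback, norm_comp_of_surjective hsurj,
    lipNumber_comp_of_isometry hφ hsurj, lipSumNorm]

theorem lipMaxNorm_lipPullback {φ : C(K₂, K₁)} (hφ : Isometry φ) (hsurj : Function.Surjective φ)
    (f : Lip K₁) : lipMaxNorm (lipPullback hφ.lipschitz f) = lipMaxNorm f := by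
  rw [lipMaxNorm, coe_lipPullback, norm_comp_of_surjective hsurj,
    lipNumber_comp_of_isometry hφ hsurj, lipMaxNorm]

end Pullback

theorem corollary3p3 {K₁ K₂ : Type*} [MetricSpace K₁] [CompactSpace K₁]
    [MetricSpace K₂] [CompactSpace K₂] :
    (∀ T : Lip K₁ →ₗ[ℂ] Lip K₂,
      Function.Surjective T → IsIsometryFor lipSumNorm lipSumNorm T → T 1 = 1 →
        ∃ φ : K₂ → K₁, Isometry φ ∧ Function.Surjective φ ∧
          ∀ (f : Lip K₁) (x : K₂), (T f : C(K₂, ℂ)) x = (f : C(K₁, ℂ)) (φ x)) ∧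
    (∀ (φ : K₂ → K₁) (hφ : Isometry φ), Function.Surjective φ →
      (∀ f : Lip K₁, (f : C(K₁, ℂ)).comp ⟨φ, hφ.continuous⟩ ∈ Lip K₂) ∧
      ∀ T : Lip K₁ → Lip K₂,
        (∀ (f : Lip K₁) (x : K₂), (T f : C(K₂, ℂ)) x = (f : C(K₁, ℂ)) (φ x)) →
          IsLinearMap ℂ T ∧ Function.Surjective T ∧ T 1 = 1 ∧
            IsIsometryFor lipSumNorm lipSumNorm T ∧ IsIsometryFor lipMaxNorm lipMaxNorm T) := by
  refine ⟨fun T hsurj hiso hone => ?_, fun φ hφ hsurj => ⟨comp_mem_lip hφ.lipschitz, ?_⟩⟩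
  · have hT : IsUnitalLipIsometry T := ⟨isIsometryFor_iff.1 hiso, hone⟩
    let e := LinearEquiv.ofBijective T ⟨hT.injective, hsurj⟩
    have nonempty_iff : Nonempty K₁ ↔ Nonempty K₂ := by
      rw [← nontrivial_lip_iff, ← nontrivial_lip_iff, e.toEquiv.nontrivial_congr]
    rcases isEmpty_or_nonempty K₂ with hK₂ | hK₂
    · have hK₁ : IsEmpty K₁ := by rwa [← not_nonempty_iff, nonempty_iff, not_nonempty_iff]
      exact ⟨isEmptyElim, isEmptyElim, isEmptyElim, fun _ => isEmptyElim⟩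
    · have hK₁ : Nonempty K₁ := nonempty_iff.2 hK₂
      exact IsUnitalLipIsometry.exists_isometry_comp (T := e) hT
  · intro T hT
    let Φ : C(K₂, K₁) := ⟨φ, hφ.continuous⟩
    have hΦ : Isometry Φ := hφ
    obtain rfl : T = lipPullback hΦ.lipschitz :=
      funext fun f => Subtype.ext (ContinuousMap.ext (hT f))
    have inv_lip := hφ.antilipschitz.to_rightInverse (Function.rightInverse_surjInv hsurj)
    exact ⟨(lipPullback hΦ.lipschitz).toLinearMap.isLinear,
      lipPullback_surjective _ inv_lip (Function.leftInverse_surjInv ⟨hφ.injective, hsurj⟩),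
      map_one _, isIsometryFor_iff.2 (lipSumNorm_lipPullback hΦ hsurj),
      isIsometryFor_iff.2 (lipMaxNorm_lipPullback hΦ hsurj)⟩
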